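/- Let $d\ge 2$, let $D=(0,1)^d\subset\mathbb{R}^d$, and let $u\in H^1_0(D)$ be the weak solution of the Poisson problem $-\Delta u=1$ on $D$, $u=0$ on $\partial D$, that is, $$\int_D \nabla u\cdot\nabla v\,dx=\int_D v\,dx\qquad\text{for all } v\in H^1_0(D).$$ Let $\beta<2$ be a real number. Then there is no constant $c>0$ such that $$|\nabla u(x)|^2+u(x)\ \ge\ c\,\operatorname{dist}(x,\partial D)^{\beta}\qquad\text{for a.e. } x\in D.$$ In other words, for $a=f=1$ the triple $(D,a,f)$ does not satisfy the positivity condition $\mathbf{PC}(\beta)$, which requires that for some $c>0$ one has $a(x)|\nabla u_a(x)|^2+f(x)u_a(x)\ge c\,\operatorname{dist}(x,\partial D)^\beta$ for a.e. $x\in D$, where $u_a\in H^1_0(D)$ is the weak solution of $-\operatorname{div}(a\nabla u_a)=f$ on $D$, $u_a=0$ on $\partial D$. -/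

import Mathlib

open MeasureTheory Filter Topology TopologicalSpace
open scoped Distributions ENNReal

noncomputable section

/-- `g` is the weak gradient of `u` on the open set `D ⊆ ℝ^d`:
`∫_D u ∂ᵢφ = - ∫_D gᵢ φ` for all coordinates `i` and all `φ ∈ C_c^∞(D)`.
(To be used for locally integrable `u` and `g`, so that these integrals are meaningful.) -/
def HasWeakGradient {d : ℕ} (D : Opens (EuclideanSpace ℝ (Fin d)))
    (u : EuclideanSpace ℝ (Fin d) → ℝ)
    (g : EuclideanSpace ℝ (Fin d) → EuclideanSpace ℝ (Fin d)) : Prop :=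
  ∀ (φ : 𝓓(D, ℝ)) (i : Fin d),
    ∫ x in (D : Set (EuclideanSpace ℝ (Fin d))), u x * (gradient φ x) i =
      -∫ x in (D : Set (EuclideanSpace ℝ (Fin d))), (g x) i * φ x

/-- `u ∈ H¹(D)` with weak gradient `g`: both are square integrable on `D`. -/
structure MemH1 {d : ℕ} (D : Opens (EuclideanSpace ℝ (Fin d)))
    (u : EuclideanSpace ℝ (Fin d) → ℝ)
    (g : EuclideanSpace ℝ (Fin d) → EuclideanSpace ℝ (Fin d)) : Prop where
  memLp : MemLp u 2 (volume.restrict D)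
  memLp_grad : MemLp g 2 (volume.restrict D)
  weakGrad : HasWeakGradient D u g

/-- `u ∈ H¹₀(D)` with weak gradient `g`: `u` belongs to `H¹(D)` and is the limit, in the
`H¹(D)`-norm, of a sequence of functions from `C_c^∞(D)`. -/
structure MemH10 {d : ℕ} (D : Opens (EuclideanSpace ℝ (Fin d)))
    (u : EuclideanSpace ℝ (Fin d) → ℝ)
    (g : EuclideanSpace ℝ (Fin d) → EuclideanSpace ℝ (Fin d)) : Prop extends MemH1 D u g where
  exists_approx : ∃ φ : ℕ → 𝓓(D, ℝ),
    Tendsto (fun n ↦ eLpNorm (fun x ↦ φ n x - u x) 2 (volume.restrict D)) atTop (𝓝 0) ∧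
    Tendsto (fun n ↦ eLpNorm (fun x ↦ gradient (φ n) x - g x) 2 (volume.restrict D))
      atTop (𝓝 0)

/-- `u ∈ H¹₀(D)`, with weak gradient `g`, is a weak solution of the Dirichlet problem
`-div (a ∇u) = f` on `D`, `u = 0` on `∂D`:
`∫_D a ∇u · ∇v = ∫_D f v` for all `v ∈ H¹₀(D)`.
Here `a` is a bounded scalar coefficient and `f` is a right side in `L²(D)`. -/
structure IsWeakSolution {d : ℕ} (D : Opens (EuclideanSpace ℝ (Fin d)))
    (a f : EuclideanSpace ℝ (Fin d) → ℝ)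
    (u : EuclideanSpace ℝ (Fin d) → ℝ)
    (g : EuclideanSpace ℝ (Fin d) → EuclideanSpace ℝ (Fin d)) : Prop where
  memH10 : MemH10 D u g
  integral_eq : ∀ (v : EuclideanSpace ℝ (Fin d) → ℝ)
    (gv : EuclideanSpace ℝ (Fin d) → EuclideanSpace ℝ (Fin d)), MemH10 D v gv →
    ∫ x in (D : Set (EuclideanSpace ℝ (Fin d))), a x * inner ℝ (g x) (gv x) =
      ∫ x in (D : Set (EuclideanSpace ℝ (Fin d))), f x * v x

/-- The positivity condition `PC(β)` for the triple `(D, a, f)`: there is `c > 0` such that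
`a(x) |∇u_a(x)|² + f(x) u_a(x) ≥ c dist(x, ∂D)^β` for a.e. `x ∈ D`,
where `u_a` is the weak solution of `-div (a ∇u) = f`, `u = 0` on `∂D`. On a bounded domain, for
`a` bounded between positive constants and `f ∈ L²(D)`, the pair `(u_a, ∇u_a)` exists and is unique
up to null sets; the quantifier over `(u, g)` picks this one pair (in all of its
a.e.-representatives). In particular the negation of the condition includes the existence of
the solution. -/
def PositivityCondition {d : ℕ} (D : Opens (EuclideanSpace ℝ (Fin d)))
    (a f : EuclideanSpace ℝ (Fin d) → ℝ) (β : ℝ) : Prop :=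
  ∃ c : ℝ, 0 < c ∧
    ∀ (u : EuclideanSpace ℝ (Fin d) → ℝ)
      (g : EuclideanSpace ℝ (Fin d) → EuclideanSpace ℝ (Fin d)), IsWeakSolution D a f u g →
      ∀ᵐ x ∂(volume.restrict (D : Set (EuclideanSpace ℝ (Fin d)))),
        c * Metric.infDist x (frontier (D : Set (EuclideanSpace ℝ (Fin d)))) ^ β ≤
          a x * ‖g x‖ ^ 2 + f x * u x

/-- The open unit cube `(0,1)^d` in `ℝ^d`. -/
def unitCube (d : ℕ) : Opens (EuclideanSpace ℝ (Fin d)) where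
  carrier := {x | ∀ i, 0 < x i ∧ x i < 1}
  is_open' := by
    simp only [Set.ofPred_forall]
    refine isOpen_iInter_of_finite fun i ↦ ?_
    have hc : Continuous fun x : EuclideanSpace ℝ (Fin d) ↦ x i := by fun_prop
    exact (isOpen_lt continuous_const hc).and (isOpen_lt hc continuous_const)

end

/-!
Let `q = xᵢ² + xⱼ²` be the squared distance to the plane containing a codimension two edge of the
cube, with `i ≠ j`. Near the edge the solution behaves like `q log (1 / q)` and its gradient like
`q ^ (1 / 2) log (1 / q)`, so `|∇u|² + u` decays almost as fast as the square of the distance to the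
edge, and no exponent `β < 2` is possible. Only the integrated form of this decay is needed: for
every `s < 2` the integral of `(q + δ)^(-s) (|∇u|² + u)` over the cube stays bounded as `δ → 0`.

The bound is obtained by testing the equation with `ρ u`, where `ρ = (q + δ)^(-s)`. A function that
vanishes on the two faces adjacent to the edge satisfies the Hardy inequality
`∫ |∇ψ|² ≥ 4 ∫ ψ² / q`. It follows from completing the square with the field `F = ∇h / h`, where
`h = xᵢ xⱼ / q`, because `-div F - |F|² = 4 / q`. For `ψ = ρ^(1/2) φ` it absorbs the commutator
terms, of size at most `s² ψ² / q`, exactly when `s < 2` (`weighted_coercivity`). Young's inequality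
and a passage to the limit from test functions then bound the weighted energy of `u` by the integral
of `(q + δ)^(1 - s)` (`exists_weighted_energy_bound`), which is dominated by the integrable function
`(xᵢ xⱼ)^(1 - s)` (`exists_integral_edgeWeight_le`).

If the lower bound `c dist(x, ∂D)^β` held, then a box of side length `r` next to the edge
would contribute at least a constant times `r ^ (2 + β - 2 s)` to the weighted integral. This is
unbounded as `r → 0` if `s` is close to `2` (`not_lower_bound_of_weighted_integral_le`).

The positivity condition quantifies over weak solutions, so the existence of one is part of the
claim (`exists_isWeakSolution`). It follows from the Lax–Milgram theorem on the closure of the pairs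
`(φ, ∇φ)` in `L² × L²`; the Poincaré inequality is the case `s = 0` of the weighted coercivity.
-/

/-! ### Test functions and their gradients -/

section TestFunctions

variable {d : ℕ} {D : Opens (EuclideanSpace ℝ (Fin d))}

theorem gradient_apply_eq_fderiv (f : EuclideanSpace ℝ (Fin d) → ℝ)
    (x : EuclideanSpace ℝ (Fin d)) (i : Fin d) :
    (gradient f x) i = fderiv ℝ f x (EuclideanSpace.single i 1) := by
  rw [← inner_gradient_left, EuclideanSpace.inner_single_right]
  simp

theorem gradient_mul {f g : EuclideanSpace ℝ (Fin d) → ℝ} {x : EuclideanSpace ℝ (Fin d)}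
    (hf : DifferentiableAt ℝ f x) (hg : DifferentiableAt ℝ g x) :
    gradient (fun y ↦ f y * g y) x = f x • gradient g x + g x • gradient f x := by
  ext i
  simp [gradient_apply_eq_fderiv, fderiv_fun_mul hf hg]

theorem continuous_gradient {f : EuclideanSpace ℝ (Fin d) → ℝ} (hf : ContDiff ℝ 1 f) :
    Continuous (gradient f) := by
  have h := hf.continuous_fderiv one_ne_zero
  exact (InnerProductSpace.toDual ℝ (EuclideanSpace ℝ (Fin d))).symm.continuous.comp h

theorem tsupport_gradient_subset (f : EuclideanSpace ℝ (Fin d) → ℝ) :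
    tsupport (gradient f) ⊆ tsupport f := by
  refine (closure_mono fun x hx ↦ ?_).trans (tsupport_fderiv_subset ℝ (f := f))
  contrapose! hx
  simp only [Function.mem_support, ne_eq, not_not] at hx ⊢
  simp [gradient, hx]

/-- A compactly supported `C¹` function has mean zero partial derivatives. -/
theorem integral_gradient_apply_eq_zero {f : EuclideanSpace ℝ (Fin d) → ℝ}
    (hf : ContDiff ℝ 1 f) (hc : HasCompactSupport f) (i : Fin d) :
    ∫ x, (gradient f x) i = 0 := by
  have h := integral_mul_fderiv_eq_neg_fderiv_mul_of_integrable (μ := volume)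
    (f := f) (g := fun _ : EuclideanSpace ℝ (Fin d) ↦ (1 : ℝ))
    (v := EuclideanSpace.single i 1) ?_ ?_ ?_ ?_ ?_
  · simpa [gradient_apply_eq_fderiv] using h
  · simp only [mul_one]
    exact ((hf.continuous_fderiv one_ne_zero).clm_apply
      continuous_const).integrable_of_hasCompactSupport (hc.fderiv_apply ℝ _)
  · simp
  · simpa using hf.continuous.integrable_of_hasCompactSupport hc
  · exact fun x _ ↦ hf.differentiable one_ne_zero x
  · exact fun x _ ↦ differentiableAt_const _

namespace TestFunction

theorem contDiff_one (φ : 𝓓(D, ℝ)) : ContDiff ℝ 1 φ :=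
  φ.contDiff.of_le (mod_cast le_top)

theorem differentiableAt (φ : 𝓓(D, ℝ)) (x : EuclideanSpace ℝ (Fin d)) :
    DifferentiableAt ℝ φ x :=
  φ.contDiff_one.differentiable one_ne_zero x

theorem eq_zero_of_notMem (φ : 𝓓(D, ℝ)) {x : EuclideanSpace ℝ (Fin d)} (hx : x ∉ D) :
    φ x = 0 :=
  image_eq_zero_of_notMem_tsupport fun h ↦ hx (φ.tsupport_subset h)

theorem hasCompactSupport_gradient (φ : 𝓓(D, ℝ)) : HasCompactSupport (gradient φ) :=
  φ.hasCompactSupport.mono' ((subset_tsupport _).trans (tsupport_gradient_subset _))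

theorem memLp (φ : 𝓓(D, ℝ)) (s : Set (EuclideanSpace ℝ (Fin d))) (p : ℝ≥0∞) :
    MemLp φ p (volume.restrict s) :=
  (φ.continuous.memLp_of_hasCompactSupport φ.hasCompactSupport).restrict s

theorem memLp_gradient (φ : 𝓓(D, ℝ)) (s : Set (EuclideanSpace ℝ (Fin d))) (p : ℝ≥0∞) :
    MemLp (gradient φ) p (volume.restrict s) :=
  ((continuous_gradient φ.contDiff_one).memLp_of_hasCompactSupport
    φ.hasCompactSupport_gradient).restrict s

/-- The product of a test function with a smooth function. -/
noncomputable def smoothMul (η : EuclideanSpace ℝ (Fin d) → ℝ) (hη : ContDiff ℝ (⊤ : ℕ∞) η)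
    (φ : 𝓓(D, ℝ)) : 𝓓(D, ℝ) where
  toFun x := η x * φ x
  contDiff' := hη.mul φ.contDiff
  hasCompactSupport' := φ.hasCompactSupport.mul_left
  tsupport_subset' := (closure_mono (Function.support_mul_subset_right _ _)).trans
    φ.tsupport_subset

/-- Test functions belong to `H¹₀(D)`, the weak gradient being the classical one. -/
theorem memH10 (φ : 𝓓(D, ℝ)) : MemH10 D φ (gradient φ) where
  memLp := φ.memLp _ _
  memLp_grad := φ.memLp_gradient _ _
  weakGrad ψ i := by
    have h := integral_gradient_apply_eq_zero (f := fun x ↦ φ x * ψ x)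
      (φ.contDiff_one.mul ψ.contDiff_one) φ.hasCompactSupport.mul_right i
    have h1 : Integrable fun x ↦ φ x * (gradient ψ x) i :=
      (φ.continuous.mul ((EuclideanSpace.proj (𝕜 := ℝ) i).continuous.comp
        (continuous_gradient ψ.contDiff_one))).integrable_of_hasCompactSupport
        φ.hasCompactSupport.mul_right
    have h2 : Integrable fun x ↦ (gradient φ x) i * ψ x :=
      (((EuclideanSpace.proj (𝕜 := ℝ) i).continuous.comp
        (continuous_gradient φ.contDiff_one)).mul ψ.continuous).integrable_of_hasCompactSupport
        ψ.hasCompactSupport.mul_left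
    rw [setIntegral_eq_integral_of_forall_compl_eq_zero fun x hx ↦ by
        rw [φ.eq_zero_of_notMem hx, zero_mul],
      setIntegral_eq_integral_of_forall_compl_eq_zero fun x hx ↦ by
        rw [ψ.eq_zero_of_notMem hx, mul_zero], eq_neg_iff_add_eq_zero, ← integral_add h1 h2, ← h]
    congr 1 with x
    rw [gradient_mul (φ.differentiableAt x) (ψ.differentiableAt x)]
    simp [mul_comm]
  exists_approx := ⟨fun _ ↦ φ, by simp, by simp⟩

end TestFunction

end TestFunctions

/-! ### Existence of weak solutions -/

section Existence

variable {d : ℕ} (D : Opens (EuclideanSpace ℝ (Fin d)))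

/-- The Hilbert space `L²(D) × L²(D; ℝ^d)`, in which `H¹₀(D)` is realised through the pairs
`(u, ∇u)`. -/
abbrev SobolevPair : Type :=
  WithLp 2 (Lp ℝ 2 (volume.restrict (D : Set (EuclideanSpace ℝ (Fin d)))) ×
    Lp (EuclideanSpace ℝ (Fin d)) 2 (volume.restrict (D : Set (EuclideanSpace ℝ (Fin d)))))

/-- The map `φ ↦ (φ, ∇φ)` from test functions to `L²(D) × L²(D; ℝ^d)`. -/
noncomputable def testPair : 𝓓(D, ℝ) →ₗ[ℝ] SobolevPair D where
  toFun φ := WithLp.toLp 2 ((φ.memLp D 2).toLp φ, (φ.memLp_gradient D 2).toLp (gradient φ))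
  map_add' φ ψ := by
    have h : gradient (φ + ψ : 𝓓(D, ℝ)) = gradient φ + gradient ψ := by
      ext x i
      simp [gradient_apply_eq_fderiv, FunLike.coe_add,
        fderiv_add (φ.differentiableAt x) (ψ.differentiableAt x)]
    have h1 : ((φ + ψ).memLp D 2).toLp _ = (φ.memLp D 2).toLp φ + (ψ.memLp D 2).toLp ψ :=
      MemLp.toLp_add _ _
    have h2 : ((φ + ψ).memLp_gradient D 2).toLp _ =
        (φ.memLp_gradient D 2).toLp _ + (ψ.memLp_gradient D 2).toLp _ :=
      (MemLp.toLp_congr _ ((φ.memLp_gradient D 2).add (ψ.memLp_gradient D 2)) (by rw [h])).trans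
        (MemLp.toLp_add _ _)
    rw [h1, h2]
    rfl
  map_smul' c φ := by
    have h : gradient (c • φ : 𝓓(D, ℝ)) = c • gradient φ := by
      ext x i
      simp [gradient_apply_eq_fderiv, FunLike.coe_smul,
        fderiv_const_smul (φ.differentiableAt x) c]
    have h1 : ((c • φ).memLp D 2).toLp _ = c • (φ.memLp D 2).toLp φ :=
      MemLp.toLp_const_smul _ _
    have h2 : ((c • φ).memLp_gradient D 2).toLp _ = c • (φ.memLp_gradient D 2).toLp _ :=
      (MemLp.toLp_congr _ ((φ.memLp_gradient D 2).const_smul c) (by rw [h])).trans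
        (MemLp.toLp_const_smul _ _)
    rw [h1, h2]
    rfl

/-- `H¹₀(D)` as a closed subspace of `L²(D) × L²(D; ℝ^d)`. -/
noncomputable def sobolevZero : Submodule ℝ (SobolevPair D) :=
  (LinearMap.range (testPair D)).topologicalClosure

variable {D}

/-- Convergence of `(φₙ, ∇φₙ)` in the product Hilbert space is
`H¹(D)`-convergence as in `MemH10`. -/
theorem tendsto_testPair_iff (φ : ℕ → 𝓓(D, ℝ)) (x : SobolevPair D) :
    Tendsto (fun n ↦ testPair D (φ n)) atTop (𝓝 x) ↔
      Tendsto (fun n ↦ eLpNorm (fun y ↦ φ n y - x.fst y) 2 (volume.restrict D)) atTop (𝓝 0) ∧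
      Tendsto (fun n ↦ eLpNorm (fun y ↦ gradient (φ n) y - x.snd y) 2 (volume.restrict D))
        atTop (𝓝 0) := by
  have h1 : ∀ n, eLpNorm (⇑(((φ n).memLp D 2).toLp (φ n)) - ⇑x.fst) 2 (volume.restrict D) =
      eLpNorm (fun y ↦ φ n y - x.fst y) 2 (volume.restrict D) := fun n ↦ by
    refine eLpNorm_congr_ae ?_
    filter_upwards [((φ n).memLp D 2).coeFn_toLp] with y hy
    simp [hy]
  have h2 : ∀ n, eLpNorm (⇑(((φ n).memLp_gradient D 2).toLp (gradient (φ n))) - ⇑x.snd) 2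
      (volume.restrict D) =
      eLpNorm (fun y ↦ gradient (φ n) y - x.snd y) 2 (volume.restrict D) := fun n ↦ by
    refine eLpNorm_congr_ae ?_
    filter_upwards [((φ n).memLp_gradient D 2).coeFn_toLp] with y hy
    simp [hy]
  simp only [← h1, ← h2]
  rw [← Lp.tendsto_Lp_iff_tendsto_eLpNorm', ← Lp.tendsto_Lp_iff_tendsto_eLpNorm']
  refine Iff.trans ?_ (Prod.tendsto_iff (fun n ↦ ((((φ n).memLp D 2).toLp (φ n)),
      ((φ n).memLp_gradient D 2).toLp (gradient (φ n)))) (x.fst, x.snd))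
  exact (WithLp.homeomorphProd 2 _ _).isInducing.tendsto_nhds_iff

theorem memH10_of_mem_sobolevZero {x : SobolevPair D} (hx : x ∈ sobolevZero D) :
    MemH10 D x.fst x.snd where
  memLp := Lp.memLp _
  memLp_grad := Lp.memLp _
  weakGrad ψ i := by
    -- Both sides are continuous in the pair, and they agree on test functions.
    have hψ : MemLp (fun y ↦ gradient ψ y i) 2
        (volume.restrict (D : Set (EuclideanSpace ℝ (Fin d)))) :=
      (EuclideanSpace.proj (𝕜 := ℝ) i).comp_memLp' (ψ.memLp_gradient D 2)
    have hψ' : MemLp (fun y ↦ ψ y • EuclideanSpace.single i (1 : ℝ)) 2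
        (volume.restrict (D : Set (EuclideanSpace ℝ (Fin d)))) :=
      ((ContinuousLinearMap.id ℝ ℝ).smulRight (EuclideanSpace.single i (1 : ℝ))).comp_memLp'
        (ψ.memLp D 2)
    have e1 : ∀ y : SobolevPair D, inner ℝ (hψ.toLp _) y.fst =
        ∫ t in (D : Set (EuclideanSpace ℝ (Fin d))), y.fst t * (gradient ψ t) i := fun y ↦ by
      rw [L2.inner_def]
      refine integral_congr_ae ?_
      filter_upwards [hψ.coeFn_toLp] with t ht
      simp [ht]
    have e2 : ∀ y : SobolevPair D, inner ℝ (hψ'.toLp _) y.snd =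
        ∫ t in (D : Set (EuclideanSpace ℝ (Fin d))), (y.snd t) i * ψ t := fun y ↦ by
      rw [L2.inner_def]
      refine integral_congr_ae ?_
      filter_upwards [hψ'.coeFn_toLp] with t ht
      simp [ht, inner_smul_left, EuclideanSpace.inner_single_left, mul_comm]
    have hcl : IsClosed {y : SobolevPair D |
        inner ℝ (hψ.toLp _) y.fst = -inner ℝ (hψ'.toLp _) y.snd} := by
      refine isClosed_eq ?_ ?_
      · exact continuous_const.inner (WithLp.prod_continuous_ofLp 2 _ _).fst
      · exact (continuous_const.inner (WithLp.prod_continuous_ofLp 2 _ _).snd).neg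
    have hmem : x ∈ {y : SobolevPair D |
        inner ℝ (hψ.toLp _) y.fst = -inner ℝ (hψ'.toLp _) y.snd} := by
      refine closure_minimal ?_ hcl hx
      rintro _ ⟨φ, rfl⟩
      simp only [Set.mem_ofPred_eq]
      rw [e1, e2]
      refine Eq.trans ?_ ((φ.memH10.weakGrad ψ i).trans ?_)
      · refine integral_congr_ae ?_
        filter_upwards [(φ.memLp D 2).coeFn_toLp] with t ht
        simp [testPair, ht]
      · congr 1
        refine integral_congr_ae ?_
        filter_upwards [(φ.memLp_gradient D 2).coeFn_toLp] with t ht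
        simp [testPair, ht]
    rw [← e1, ← e2]
    exact hmem
  exists_approx := by
    obtain ⟨y, hy, hlim⟩ := mem_closure_iff_seq_limit.1 hx
    choose φ hφ using hy
    refine ⟨φ, (tendsto_testPair_iff φ x).1 ?_⟩
    simpa only [hφ] using hlim

theorem toLp_mem_sobolevZero {v : EuclideanSpace ℝ (Fin d) → ℝ}
    {gv : EuclideanSpace ℝ (Fin d) → EuclideanSpace ℝ (Fin d)} (hv : MemH10 D v gv) :
    (WithLp.toLp 2 (hv.memLp.toLp v, hv.memLp_grad.toLp gv) : SobolevPair D) ∈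
      sobolevZero D := by
  obtain ⟨φ, h1, h2⟩ := hv.exists_approx
  refine mem_closure_iff_seq_limit.2 ⟨fun n ↦ testPair D (φ n), fun n ↦ ⟨φ n, rfl⟩,
    (tendsto_testPair_iff _ _).2 ⟨?_, ?_⟩⟩
  · refine h1.congr fun n ↦ eLpNorm_congr_ae ?_
    filter_upwards [hv.memLp.coeFn_toLp] with t ht
    simp [ht]
  · refine h2.congr fun n ↦ eLpNorm_congr_ae ?_
    filter_upwards [hv.memLp_grad.coeFn_toLp] with t ht
    simp [ht]

/-- Under a Poincaré inequality for test functions, Lax–Milgram yields a weak solution of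
`-Δu = f` in `H¹₀(D)` for each `f ∈ L²(D)`. -/
theorem exists_isWeakSolution {C : ℝ}
    (hC : ∀ φ : 𝓓(D, ℝ), ∫ x in (D : Set (EuclideanSpace ℝ (Fin d))), φ x ^ 2 ≤
      C * ∫ x in (D : Set (EuclideanSpace ℝ (Fin d))), ‖gradient φ x‖ ^ 2)
    {f : EuclideanSpace ℝ (Fin d) → ℝ} (hf : MemLp f 2 (volume.restrict D)) :
    ∃ (u : EuclideanSpace ℝ (Fin d) → ℝ)
      (g : EuclideanSpace ℝ (Fin d) → EuclideanSpace ℝ (Fin d)),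
      IsWeakSolution D (fun _ ↦ 1) f u g := by
  have hcomplete : CompleteSpace (sobolevZero D) :=
    (Submodule.isClosed_topologicalClosure _).completeSpace_coe
  let P : sobolevZero D →L[ℝ]
      Lp (EuclideanSpace ℝ (Fin d)) 2 (volume.restrict (D : Set (EuclideanSpace ℝ (Fin d)))) :=
    (WithLp.sndL 2 ℝ _ _).comp (sobolevZero D).subtypeL
  let Q : sobolevZero D →L[ℝ]
      Lp ℝ 2 (volume.restrict (D : Set (EuclideanSpace ℝ (Fin d)))) :=
    (WithLp.fstL 2 ℝ _ _).comp (sobolevZero D).subtypeL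
  -- The Poincaré inequality passes to the closure, and makes the Dirichlet form coercive.
  have hpoin : ∀ x : SobolevPair D, x ∈ sobolevZero D → ‖x.fst‖ ^ 2 ≤ |C| * ‖x.snd‖ ^ 2 := by
    intro x hx
    have hcl : IsClosed {y : SobolevPair D | ‖y.fst‖ ^ 2 ≤ |C| * ‖y.snd‖ ^ 2} :=
      isClosed_le (by fun_prop) (by fun_prop)
    refine closure_minimal ?_ hcl hx
    rintro _ ⟨φ, rfl⟩
    have e1 : ‖(testPair D φ).fst‖ ^ 2 =
        ∫ x in (D : Set (EuclideanSpace ℝ (Fin d))), φ x ^ 2 := by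
      rw [← real_inner_self_eq_norm_sq, L2.inner_def]
      refine integral_congr_ae ?_
      filter_upwards [(φ.memLp D 2).coeFn_toLp] with t ht
      simp [testPair, ht, sq]
    have e2 : ‖(testPair D φ).snd‖ ^ 2 =
        ∫ x in (D : Set (EuclideanSpace ℝ (Fin d))), ‖gradient φ x‖ ^ 2 := by
      rw [← real_inner_self_eq_norm_sq, L2.inner_def]
      refine integral_congr_ae ?_
      filter_upwards [(φ.memLp_gradient D 2).coeFn_toLp] with t ht
      simp [testPair, ht]
    simp only [Set.mem_ofPred_eq]
    rw [e1, e2]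
    refine (hC φ).trans (mul_le_mul_of_nonneg_right (le_abs_self C) ?_)
    exact integral_nonneg fun _ ↦ by positivity
  let B : sobolevZero D →L[ℝ] sobolevZero D →L[ℝ] ℝ := (innerSL ℝ).bilinearComp P P
  have hB : ∀ x y, B x y = inner ℝ (P x) (P y) := fun x y ↦ rfl
  have hcoer : IsCoercive B := by
    refine ⟨(|C| + 1)⁻¹, by positivity, fun x ↦ ?_⟩
    have h := hpoin x x.2
    have h3 : ‖x‖ * ‖x‖ = ‖(x : SobolevPair D).fst‖ ^ 2 + ‖(x : SobolevPair D).snd‖ ^ 2 := by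
      rw [← sq, ← WithLp.prod_norm_sq_eq_of_L2]
      rfl
    have h4 : B x x = ‖(x : SobolevPair D).snd‖ ^ 2 := by
      rw [hB, real_inner_self_eq_norm_sq]
      rfl
    rw [h4, mul_assoc, h3, inv_mul_le_iff₀ (by positivity)]
    linarith
  let F := hf.toLp f
  let l : StrongDual ℝ (sobolevZero D) := (innerSL ℝ F).comp Q
  let s : sobolevZero D :=
    hcoer.continuousLinearEquivOfBilin.symm ((InnerProductSpace.toDual ℝ _).symm l)
  have hs : ∀ v, inner ℝ (P s) (P v) = inner ℝ F (Q v) := fun v ↦ by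
    rw [← hB, ← hcoer.continuousLinearEquivOfBilin_apply]
    simp only [s, ContinuousLinearEquiv.apply_symm_apply, InnerProductSpace.toDual_symm_apply]
    rfl
  refine ⟨_, _, memH10_of_mem_sobolevZero s.2, fun v gv hv ↦ ?_⟩
  have h := hs ⟨_, toLp_mem_sobolevZero hv⟩
  rw [L2.inner_def, L2.inner_def] at h
  refine Eq.trans ?_ (h.trans ?_)
  · refine integral_congr_ae ?_
    filter_upwards [hv.memLp_grad.coeFn_toLp] with t ht
    simp only [one_mul]
    congr 1
    exact ht.symm
  · refine integral_congr_ae ?_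
    filter_upwards [hv.memLp.coeFn_toLp, hf.coeFn_toLp] with t ht ht'
    have e : (Q ⟨_, toLp_mem_sobolevZero hv⟩ : EuclideanSpace ℝ (Fin d) → ℝ) t = v t := ht
    rw [e, show F t = f t from ht']
    simp [mul_comm]

end Existence

/-! ### A weighted Hardy inequality near an edge -/

section EdgeWeight

variable {d : ℕ} {D : Opens (EuclideanSpace ℝ (Fin d))}

/-- The regularised squared distance `xᵢ² + xⱼ² + δ` to the codimension two plane
`{xᵢ = xⱼ = 0}`. -/
def edgeDistSq (i j : Fin d) (δ : ℝ) (x : EuclideanSpace ℝ (Fin d)) : ℝ :=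
  x i ^ 2 + x j ^ 2 + δ

/-- The weight `(xᵢ² + xⱼ² + δ)^(-s)`, which for `δ → 0` blows up at the codimension two plane
`{xᵢ = xⱼ = 0}`. -/
noncomputable def edgeWeight (i j : Fin d) (s δ : ℝ) (x : EuclideanSpace ℝ (Fin d)) : ℝ :=
  edgeDistSq i j δ x ^ (-s)

theorem edgeDistSq_pos (i j : Fin d) {δ : ℝ} (hδ : 0 < δ) (x : EuclideanSpace ℝ (Fin d)) :
    0 < edgeDistSq i j δ x := by
  unfold edgeDistSq
  positivity

theorem le_edgeDistSq (i j : Fin d) (δ : ℝ) (x : EuclideanSpace ℝ (Fin d)) :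
    δ ≤ edgeDistSq i j δ x := by
  unfold edgeDistSq
  linarith [sq_nonneg (x i), sq_nonneg (x j)]

theorem edgeWeight_pos (i j : Fin d) (s : ℝ) {δ : ℝ} (hδ : 0 < δ)
    (x : EuclideanSpace ℝ (Fin d)) : 0 < edgeWeight i j s δ x :=
  Real.rpow_pos_of_pos (edgeDistSq_pos i j hδ x) _

theorem contDiff_edgeDistSq (i j : Fin d) (δ : ℝ) {n : WithTop ℕ∞} :
    ContDiff ℝ n (edgeDistSq i j δ) := by
  have h (k : Fin d) : ContDiff ℝ n fun x : EuclideanSpace ℝ (Fin d) ↦ x k :=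
    (EuclideanSpace.proj (𝕜 := ℝ) k).contDiff
  exact (((h i).pow 2).add ((h j).pow 2)).add contDiff_const

theorem contDiff_edgeWeight (i j : Fin d) (s : ℝ) {δ : ℝ} (hδ : 0 < δ) {n : WithTop ℕ∞} :
    ContDiff ℝ n (edgeWeight i j s δ) :=
  (contDiff_edgeDistSq i j δ).rpow_const_of_ne fun x ↦ (edgeDistSq_pos i j hδ x).ne'

theorem gradient_apply_of_hasDerivAt {f : EuclideanSpace ℝ (Fin d) → ℝ}
    {x : EuclideanSpace ℝ (Fin d)} {i : Fin d} {c : ℝ} (hf : DifferentiableAt ℝ f x)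
    (h : HasDerivAt (fun t : ℝ ↦ f (x + t • EuclideanSpace.single i (1 : ℝ))) c 0) :
    (gradient f x) i = c := by
  rw [gradient_apply_eq_fderiv, ← hf.lineDeriv_eq_fderiv]
  exact h.deriv

theorem gradient_edgeWeight (i j : Fin d) (s : ℝ) {δ : ℝ} (hδ : 0 < δ)
    (x : EuclideanSpace ℝ (Fin d)) :
    gradient (edgeWeight i j s δ) x =
      (-2 * s * (edgeWeight i j s δ x / edgeDistSq i j δ x)) •
        (x i • EuclideanSpace.single i (1 : ℝ) + x j • EuclideanSpace.single j (1 : ℝ)) := by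
  have hQ := edgeDistSq_pos i j hδ x
  have h (k : Fin d) : HasFDerivAt (fun x : EuclideanSpace ℝ (Fin d) ↦ x k)
      (EuclideanSpace.proj (𝕜 := ℝ) k) x := (EuclideanSpace.proj (𝕜 := ℝ) k).hasFDerivAt
  have h1 := ((((h i).pow 2).add ((h j).pow 2)).add_const δ).rpow_const (p := -s)
    (Or.inl hQ.ne')
  ext k
  rw [gradient_apply_eq_fderiv]
  have h2 : fderiv ℝ (edgeWeight i j s δ) x = _ := h1.fderiv
  have h3 : (x i ^ 2 + x j ^ 2 + δ) ^ (-s - 1) =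
      edgeWeight i j s δ x / edgeDistSq i j δ x := Real.rpow_sub_one hQ.ne' _
  rw [h2]
  simp [h3, PiLp.single_apply, eq_comm]
  ring_nf

/-- The logarithmic derivative `∂₁h / h` of `h = xy / (x² + y²)`, that is, of `sin 2θ` up to a
factor. As `h` is symmetric, `∂₂h / h` at `(a, b)` is `profileField b a`. -/
noncomputable def profileField (a b : ℝ) : ℝ := a⁻¹ - 2 * a / (a ^ 2 + b ^ 2)

theorem hasDerivAt_profileField {a b : ℝ} (ha : a ≠ 0) :
    HasDerivAt (fun t ↦ profileField (a + t) b)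
      (-(a ^ 2)⁻¹ - 2 / (a ^ 2 + b ^ 2) + 4 * a ^ 2 / (a ^ 2 + b ^ 2) ^ 2) 0 := by
  have hq : a ^ 2 + b ^ 2 ≠ 0 := by positivity
  have h0 : HasDerivAt (fun t ↦ a + t) 1 0 := by
    simpa using (hasDerivAt_id (0 : ℝ)).const_add a
  have h1 := h0.inv (by simpa using ha)
  have h2 := (h0.const_mul 2).div ((h0.pow 2).add_const (b ^ 2)) (by simpa using hq)
  refine (h1.sub h2).congr_deriv ?_
  simp
  field_simp
  ring

theorem contDiffAt_profileField {i j : Fin d} {x : EuclideanSpace ℝ (Fin d)} (hi : x i ≠ 0)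
    {n : WithTop ℕ∞} :
    ContDiffAt ℝ n (fun y : EuclideanSpace ℝ (Fin d) ↦ profileField (y i) (y j)) x := by
  have h (k : Fin d) : ContDiffAt ℝ n (fun x : EuclideanSpace ℝ (Fin d) ↦ x k) x :=
    (EuclideanSpace.proj (𝕜 := ℝ) k).contDiff.contDiffAt
  exact ((h i).inv hi).sub ((contDiffAt_const.mul (h i)).div (((h i).pow 2).add ((h j).pow 2))
    (by positivity))

theorem gradient_profileField_apply {i j : Fin d} (hij : i ≠ j) {x : EuclideanSpace ℝ (Fin d)}
    (hi : x i ≠ 0) :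
    (gradient (fun y : EuclideanSpace ℝ (Fin d) ↦ profileField (y i) (y j)) x) i =
      -(x i ^ 2)⁻¹ - 2 / (x i ^ 2 + x j ^ 2) + 4 * x i ^ 2 / (x i ^ 2 + x j ^ 2) ^ 2 := by
  refine gradient_apply_of_hasDerivAt
    ((contDiffAt_profileField (n := 1) hi).differentiableAt one_ne_zero) ?_
  simpa [hij, hij.symm] using hasDerivAt_profileField (b := x j) hi

/-- The vector field component `ρ φ² Fᵢ`, extended by zero outside `D`, is `C¹`: the singularities
of `F` lie off the support of `φ`. -/
theorem contDiff_weight_mul_profileField {i j : Fin d} (hD : ∀ x ∈ D, x i ≠ 0)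
    {ρ : EuclideanSpace ℝ (Fin d) → ℝ} (hρ : ContDiff ℝ 1 ρ) (φ : 𝓓(D, ℝ)) :
    ContDiff ℝ 1 fun x ↦ ρ x * (φ x * φ x) * profileField (x i) (x j) := by
  refine contDiff_iff_contDiffAt.2 fun x ↦ ?_
  by_cases hx : x ∈ tsupport φ
  · exact (hρ.mul (φ.contDiff_one.mul φ.contDiff_one)).contDiffAt.mul
      (contDiffAt_profileField (hD x (φ.tsupport_subset hx)))
  · refine (contDiffAt_const (c := (0 : ℝ))).congr_of_eventuallyEq ?_
    filter_upwards [notMem_tsupport_iff_eventuallyEq.1 hx] with y hy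
    simp [hy]

theorem gradient_weight_mul_profileField_apply {i j : Fin d} (hij : i ≠ j) {s δ : ℝ} (hδ : 0 < δ)
    (φ : 𝓓(D, ℝ)) {x : EuclideanSpace ℝ (Fin d)} (hi : x i ≠ 0) :
    (gradient (fun x ↦ edgeWeight i j s δ x * (φ x * φ x) * profileField (x i) (x j)) x) i =
      edgeWeight i j s δ x *
        (2 * φ x * (gradient φ x) i * profileField (x i) (x j)
          - 2 * s / edgeDistSq i j δ x * φ x ^ 2 * (x i * profileField (x i) (x j))
          + φ x ^ 2 * (-(x i ^ 2)⁻¹ - 2 / (x i ^ 2 + x j ^ 2)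
            + 4 * x i ^ 2 / (x i ^ 2 + x j ^ 2) ^ 2)) := by
  have hρ := (contDiff_edgeWeight i j s hδ (n := 1)).differentiable one_ne_zero x
  have hφ := φ.differentiableAt x
  have hF := (contDiffAt_profileField (n := 1) (j := j) hi).differentiableAt one_ne_zero
  have hφφ : DifferentiableAt ℝ (fun y ↦ φ y * φ y) x := hφ.mul hφ
  have hρφφ : DifferentiableAt ℝ (fun y ↦ edgeWeight i j s δ y * (φ y * φ y)) x := hρ.mul hφφ
  rw [gradient_mul hρφφ hF, gradient_mul hρ hφφ, gradient_mul hφ hφ,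
    gradient_edgeWeight i j s hδ]
  simp only [PiLp.add_apply, PiLp.smul_apply, smul_eq_mul, gradient_profileField_apply hij hi]
  simp [hij]
  ring

/-- The pointwise form of the weighted Hardy inequality. The vector field `F = ∇h / h`, with
`h = xy / (x² + y²)`, satisfies `-div F - |F|² = 4 / (x² + y²)` and is orthogonal to `(x, y)`.
The last term on the left side is the divergence of `ρ φ² F`, divided by the weight `ρ`. -/
theorem hardy_pointwise {x y a b w N s δ : ℝ} (hx : x ≠ 0) (hy : y ≠ 0) (hs0 : 0 ≤ s) (hs : s < 2)
    (hδ : 0 ≤ δ) (hN : a ^ 2 + b ^ 2 ≤ N) :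
    (4 - s ^ 2) / 32 * N + (4 - s ^ 2) / 4 * (w ^ 2 / (x ^ 2 + y ^ 2 + δ)) +
      (4 + s ^ 2) / 8 * (2 * w * (a * profileField x y + b * profileField y x)
        - w ^ 2 * ((x ^ 2)⁻¹ + (y ^ 2)⁻¹)) ≤
      N - 2 * s * w / (x ^ 2 + y ^ 2 + δ) * (x * a + y * b) := by
  have hq : 0 < x ^ 2 + y ^ 2 := by positivity
  have hQ : 0 < x ^ 2 + y ^ 2 + δ := by positivity
  set P := (x ^ 2 + y ^ 2 + δ)⁻¹ with hP
  set F := profileField x y with hF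
  set G := profileField y x with hG
  have horth : x * F + y * G = 0 := by
    simp only [hF, hG, profileField]
    field_simp
    ring
  have hnorm : F ^ 2 + G ^ 2 = (x ^ 2)⁻¹ + (y ^ 2)⁻¹ - 4 / (x ^ 2 + y ^ 2) := by
    simp only [hF, hG, profileField]
    field_simp
    ring
  have hPq : P * (x ^ 2 + y ^ 2) ≤ 1 := by
    rw [hP, inv_mul_le_iff₀ hQ]
    linarith
  have hP0 : 0 < P := by positivity
  set Z := w ^ 2 / (x ^ 2 + y ^ 2) with hZ
  have hZ0 : 0 ≤ Z := by positivity
  have hW : w ^ 2 * P ≤ Z := by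
    rw [hZ, le_div_iff₀ hq]
    nlinarith [sq_nonneg w]
  have hV : w ^ 2 * P ^ 2 * (x ^ 2 + y ^ 2) ≤ w ^ 2 * P := by
    nlinarith [mul_nonneg (sq_nonneg w) hP0.le]
  set A := a - s * w * P * x with hA
  set B := b - s * w * P * y with hB
  have hAB : a ^ 2 + b ^ 2 - 2 * s * w * P * (x * a + y * b) =
      A ^ 2 + B ^ 2 - s ^ 2 * (w ^ 2 * P ^ 2 * (x ^ 2 + y ^ 2)) := by
    simp only [hA, hB]; ring
  have hs4 : s ^ 2 ≤ 4 := by nlinarith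
  have hab : a ^ 2 + b ^ 2 ≤ 2 * (A ^ 2 + B ^ 2) + 8 * Z := by
    have h1 : a ^ 2 + b ^ 2 ≤ 2 * (A ^ 2 + B ^ 2) +
        2 * (s ^ 2 * (w ^ 2 * P ^ 2 * (x ^ 2 + y ^ 2))) := by
      nlinarith [sq_nonneg (A - s * w * P * x), sq_nonneg (B - s * w * P * y)]
    have h2 : s ^ 2 * (w ^ 2 * P ^ 2 * (x ^ 2 + y ^ 2)) ≤ 4 * Z :=
      mul_le_mul hs4 (hV.trans hW) (by positivity) (by norm_num)
    linarith
  -- Completing the square `|(A, B) - w F|² ≥ 0`.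
  have hsq : 2 * w * (a * F + b * G) - w ^ 2 * ((x ^ 2)⁻¹ + (y ^ 2)⁻¹) + 4 * Z ≤
      A ^ 2 + B ^ 2 := by
    have h1 : A * F + B * G = a * F + b * G := by
      simp only [hA, hB]
      linear_combination (-(s * w * P)) * horth
    have h2 : 4 * Z = w ^ 2 * (4 / (x ^ 2 + y ^ 2)) := by rw [hZ]; ring
    have h3 : 0 ≤ (A - w * F) ^ 2 + (B - w * G) ^ 2 := by positivity
    rw [← h1, h2]
    linear_combination h3 + w ^ 2 * hnorm
  have hVs : s ^ 2 * (w ^ 2 * P ^ 2 * (x ^ 2 + y ^ 2)) ≤ s ^ 2 * Z :=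
    mul_le_mul_of_nonneg_left (hV.trans hW) (sq_nonneg s)
  rw [div_eq_mul_inv (w ^ 2), div_eq_mul_inv (2 * s * w), ← hP]
  have e1 := mul_le_mul_of_nonneg_left hsq (show 0 ≤ (4 + s ^ 2) / 8 by positivity)
  have e2 := mul_le_mul_of_nonneg_left hab (show 0 ≤ (4 - s ^ 2) / 32 by linarith)
  have e3 := mul_le_mul_of_nonneg_left hW (show 0 ≤ (4 - s ^ 2) / 4 by linarith)
  have e4 : 0 ≤ (28 + s ^ 2) / 32 * (N - (a ^ 2 + b ^ 2)) :=
    mul_nonneg (by positivity) (by linarith)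
  have e5 : 0 ≤ (4 - s ^ 2) / 16 * (A ^ 2 + B ^ 2) :=
    mul_nonneg (by linarith) (by positivity)
  linear_combination e1 + e2 + e3 + e4 + e5 + hVs - hAB

theorem inner_gradient_weight_mul (i j : Fin d) (s : ℝ) {δ : ℝ} (hδ : 0 < δ) (φ : 𝓓(D, ℝ))
    (x v : EuclideanSpace ℝ (Fin d)) :
    inner ℝ v (gradient (fun y ↦ edgeWeight i j s δ y * φ y) x) =
      edgeWeight i j s δ x * (inner ℝ v (gradient φ x)
        - 2 * s * φ x / edgeDistSq i j δ x * (x i * v i + x j * v j)) := by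
  rw [gradient_mul ((contDiff_edgeWeight i j s hδ (n := 1)).differentiable one_ne_zero x)
    (φ.differentiableAt x), gradient_edgeWeight i j s hδ]
  simp only [inner_add_right, inner_smul_right, EuclideanSpace.inner_single_right]
  simp
  ring

theorem sq_add_sq_le_norm_sq {i j : Fin d} (hij : i ≠ j) (v : EuclideanSpace ℝ (Fin d)) :
    v i ^ 2 + v j ^ 2 ≤ ‖v‖ ^ 2 := by
  rw [EuclideanSpace.real_norm_sq_eq, ← Finset.sum_pair (f := fun k ↦ v k ^ 2) hij]
  exact Finset.sum_le_sum_of_subset_of_nonneg (Finset.subset_univ _) fun _ _ _ ↦ sq_nonneg _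

/-- Weighted coercivity of the Dirichlet form near the codimension two plane
`{xᵢ = xⱼ = 0}`, for functions that vanish on the hyperplanes `{xᵢ = 0}` and `{xⱼ = 0}`. It rests
on the sharp constant `4 = 2²` of the Hardy inequality in a quadrant, which is why all exponents
`s < 2` are admissible. The constants do not depend on the regularisation `δ`. -/
theorem weighted_coercivity {i j : Fin d} (hij : i ≠ j) (hD : ∀ x ∈ D, x i ≠ 0 ∧ x j ≠ 0)
    {s δ : ℝ} (hs0 : 0 ≤ s) (hs : s < 2) (hδ : 0 < δ) (φ : 𝓓(D, ℝ)) :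
    ∫ x in (D : Set (EuclideanSpace ℝ (Fin d))), edgeWeight i j s δ x *
        ((4 - s ^ 2) / 32 * ‖gradient φ x‖ ^ 2
          + (4 - s ^ 2) / 4 * (φ x ^ 2 / edgeDistSq i j δ x)) ≤
      ∫ x in (D : Set (EuclideanSpace ℝ (Fin d))),
        inner ℝ (gradient φ x) (gradient (fun y ↦ edgeWeight i j s δ y * φ y) x) := by
  have hρ := contDiff_edgeWeight (d := d) i j s hδ (n := 1)
  -- The vector field `(Gi, Gj)` is `ρ φ² F`; its divergence integrates to zero.
  have hsymm : edgeWeight (d := d) j i s δ = edgeWeight i j s δ := by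
    ext x
    simp [edgeWeight, edgeDistSq, add_comm]
  set Gi : EuclideanSpace ℝ (Fin d) → ℝ :=
    fun x ↦ edgeWeight i j s δ x * (φ x * φ x) * profileField (x i) (x j) with hGi
  set Gj : EuclideanSpace ℝ (Fin d) → ℝ :=
    fun x ↦ edgeWeight i j s δ x * (φ x * φ x) * profileField (x j) (x i) with hGj
  have hci : ContDiff ℝ 1 Gi := contDiff_weight_mul_profileField (fun x hx ↦ (hD x hx).1) hρ φ
  have hcj : ContDiff ℝ 1 Gj := contDiff_weight_mul_profileField (fun x hx ↦ (hD x hx).2) hρ φ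
  have hsub (c : EuclideanSpace ℝ (Fin d) → ℝ) :
      Function.support (fun x ↦ edgeWeight i j s δ x * (φ x * φ x) * c x) ⊆ tsupport φ := by
    refine fun x hx ↦ subset_tsupport _ fun h0 ↦ hx ?_
    simp [h0]
  have hsi : HasCompactSupport Gi := φ.hasCompactSupport.mono' (hsub _)
  have hsj : HasCompactSupport Gj := φ.hasCompactSupport.mono' (hsub _)
  have hgrad {H : EuclideanSpace ℝ (Fin d) → ℝ} (hH : ContDiff ℝ 1 H) (hs : HasCompactSupport H)
      (k : Fin d) : Integrable fun x ↦ (gradient H x) k := by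
    refine ((EuclideanSpace.proj (𝕜 := ℝ) k).continuous.comp
      (continuous_gradient hH)).integrable_of_hasCompactSupport (hs.mono' fun x hx ↦ ?_)
    refine tsupport_gradient_subset _ (subset_tsupport _ fun h0 ↦ hx ?_)
    simp [h0]
  have hzero {c : EuclideanSpace ℝ (Fin d) → ℝ} {H : EuclideanSpace ℝ (Fin d) → ℝ}
      (hHc : H = fun x ↦ edgeWeight i j s δ x * (φ x * φ x) * c x)
      (hH : ContDiff ℝ 1 H) (hs : HasCompactSupport H) (k : Fin d) :
      ∫ x in (D : Set (EuclideanSpace ℝ (Fin d))), (gradient H x) k = 0 := by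
    rw [setIntegral_eq_integral_of_forall_compl_eq_zero fun x hx ↦ ?_,
      integral_gradient_apply_eq_zero hH hs k]
    have : gradient H x = 0 := by
      refine image_eq_zero_of_notMem_tsupport fun h ↦ hx (φ.tsupport_subset ?_)
      refine closure_minimal ?_ (isClosed_tsupport φ) (tsupport_gradient_subset _ h)
      rw [hHc]
      exact hsub c
    simp [this]
  have hint1 : IntegrableOn (fun x ↦ edgeWeight i j s δ x * ((4 - s ^ 2) / 32 * ‖gradient φ x‖ ^ 2
      + (4 - s ^ 2) / 4 * (φ x ^ 2 / edgeDistSq i j δ x))) D := by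
    refine (Continuous.integrable_of_hasCompactSupport ?_
      (φ.hasCompactSupport.mono' fun x hx ↦ ?_)).integrableOn
    · have h1 := continuous_gradient φ.contDiff_one
      have h2 := φ.continuous
      have h3 := (contDiff_edgeDistSq (d := d) i j δ (n := 0)).continuous
      exact hρ.continuous.mul ((continuous_const.mul (h1.norm.pow 2)).add
        (continuous_const.mul ((h2.pow 2).div h3 fun x ↦ (edgeDistSq_pos i j hδ x).ne')))
    · by_contra hx'
      refine hx ?_
      have h1 : gradient φ x = 0 :=
        image_eq_zero_of_notMem_tsupport fun h ↦ hx' (tsupport_gradient_subset _ h)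
      simp [h1, image_eq_zero_of_notMem_tsupport hx']
  have hint2 : IntegrableOn (fun x ↦ inner ℝ (gradient φ x)
      (gradient (fun y ↦ edgeWeight i j s δ y * φ y) x)) D := by
    refine (Continuous.integrable_of_hasCompactSupport ?_
      (φ.hasCompactSupport_gradient.mono fun x hx h0 ↦ hx ?_)).integrableOn
    · exact (continuous_gradient φ.contDiff_one).inner
        (continuous_gradient (hρ.mul φ.contDiff_one))
    · simp [h0]
  have hint3 : IntegrableOn (fun x ↦ (4 + s ^ 2) / 8 * ((gradient Gi x) i + (gradient Gj x) j)) D :=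
    (((hgrad hci hsi i).add (hgrad hcj hsj j)).const_mul _).integrableOn
  have hdiv : ∫ x in (D : Set (EuclideanSpace ℝ (Fin d))),
      (4 + s ^ 2) / 8 * ((gradient Gi x) i + (gradient Gj x) j) = 0 := by
    rw [integral_const_mul, integral_add (hgrad hci hsi i).integrableOn
      (hgrad hcj hsj j).integrableOn, hzero hGi hci hsi, hzero hGj hcj hsj]
    simp
  have hmono := setIntegral_mono_on (hint1.add hint3) hint2 D.isOpen.measurableSet fun x hx ↦ ?_
  · rw [← add_zero (∫ x in (D : Set (EuclideanSpace ℝ (Fin d))), edgeWeight i j s δ x * _), ← hdiv,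
      ← integral_add hint1 hint3]
    exact hmono
  · obtain ⟨hi, hj⟩ := hD x hx
    have e1 := gradient_weight_mul_profileField_apply hij (s := s) hδ φ hi
    have e2 := gradient_weight_mul_profileField_apply hij.symm (s := s) hδ φ hj
    rw [hsymm] at e2
    have e3 : edgeDistSq j i δ x = edgeDistSq i j δ x := by simp [edgeDistSq, add_comm]
    have hq : x i ^ 2 + x j ^ 2 ≠ 0 := by positivity
    have horth : x i * profileField (x i) (x j) + x j * profileField (x j) (x i) = 0 := by
      simp only [profileField]
      field_simp
      ring
    have hdivF : (-(x i ^ 2)⁻¹ - 2 / (x i ^ 2 + x j ^ 2)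
          + 4 * x i ^ 2 / (x i ^ 2 + x j ^ 2) ^ 2) + (-(x j ^ 2)⁻¹ - 2 / (x j ^ 2 + x i ^ 2)
          + 4 * x j ^ 2 / (x j ^ 2 + x i ^ 2) ^ 2) = -((x i ^ 2)⁻¹ + (x j ^ 2)⁻¹) := by
      rw [add_comm (x j ^ 2) (x i ^ 2)]
      field_simp
      ring
    have e4 : (gradient Gi x) i + (gradient Gj x) j = edgeWeight i j s δ x *
        (2 * φ x * ((gradient φ x) i * profileField (x i) (x j)
          + (gradient φ x) j * profileField (x j) (x i))
          - φ x ^ 2 * ((x i ^ 2)⁻¹ + (x j ^ 2)⁻¹)) := by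
      rw [hGi, hGj, e1, e2, e3]
      linear_combination edgeWeight i j s δ x * φ x ^ 2 * hdivF -
        edgeWeight i j s δ x * (2 * s / edgeDistSq i j δ x * φ x ^ 2) * horth
    have h := mul_le_mul_of_nonneg_left (hardy_pointwise (w := φ x) hi hj hs0 hs hδ.le
      (sq_add_sq_le_norm_sq hij (gradient φ x))) (edgeWeight_pos i j s hδ x).le
    simp only [Pi.add_apply]
    rw [e4, inner_gradient_weight_mul i j s hδ, real_inner_self_eq_norm_sq]
    refine le_trans (le_of_eq ?_) h
    simp only [edgeDistSq]
    ring

end EdgeWeight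

/-! ### Weighted energy bound for weak solutions -/

section EnergyBound

theorem integrable_inner_of_memLp_two {α H : Type*} [MeasurableSpace α] {μ : Measure α}
    [NormedAddCommGroup H] [InnerProductSpace ℝ H] {f g : α → H} (hf : MemLp f 2 μ)
    (hg : MemLp g 2 μ) : Integrable (fun x ↦ inner ℝ (f x) (g x)) μ := by
  refine (L2.integrable_inner (𝕜 := ℝ) (hf.toLp f) (hg.toLp g)).congr ?_
  filter_upwards [hf.coeFn_toLp, hg.coeFn_toLp] with x h1 h2
  rw [h1, h2]

theorem tendsto_integral_norm_sq_of_eLpNorm {α H : Type*} [MeasurableSpace α] {μ : Measure α}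
    [NormedAddCommGroup H] {F : ℕ → α → H} (hF : ∀ n, MemLp (F n) 2 μ)
    (h : Tendsto (fun n ↦ eLpNorm (F n) 2 μ) atTop (𝓝 0)) :
    Tendsto (fun n ↦ ∫ x, ‖F n x‖ ^ 2 ∂μ) atTop (𝓝 0) := by
  have h1 : ∀ n, ∫ x, ‖F n x‖ ^ 2 ∂μ = (eLpNorm (F n) 2 μ).toReal ^ 2 := fun n ↦ by
    have h0 : 0 ≤ ∫ x, ‖F n x‖ ^ 2 ∂μ := integral_nonneg fun _ ↦ by positivity
    rw [(hF n).eLpNorm_eq_integral_rpow_norm two_ne_zero ENNReal.ofNat_ne_top]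
    simp only [ENNReal.toReal_ofNat, Real.rpow_ofNat]
    rw [ENNReal.toReal_ofReal (by positivity), ← Real.rpow_mul_natCast h0]
    simp
  simp only [h1]
  have h2 := ((ENNReal.tendsto_toReal ENNReal.zero_ne_top).comp h).pow 2
  simpa using h2

variable {d : ℕ} {D : Opens (EuclideanSpace ℝ (Fin d))}

/-- Young's inequality in the form needed to pass from test functions `φ` to the weak solution `u`:
here `p = ∇φ`, `g = ∇u` and `w` is the value of `φ`. -/
theorem energy_pointwise {i j : Fin d} (hij : i ≠ j) {x : EuclideanSpace ℝ (Fin d)}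
    (g p : EuclideanSpace ℝ (Fin d)) (u w : ℝ) {s k δ : ℝ} (hs : s ^ 2 ≤ 4) (hk : 0 < k)
    (hδ : 0 < δ) :
    k * (‖g‖ ^ 2 + u) ≤
      (4 * k * ‖p‖ ^ 2 + 32 * k * (w ^ 2 / edgeDistSq i j δ x))
      - (inner ℝ (p - g) p
        - 2 * s * w / edgeDistSq i j δ x * (x i * (p - g) i + x j * (p - g) j)) - w
      + ((1 + k) ^ 2 / (64 * k) + k) * edgeDistSq i j δ x
      + (2 * k + 3 / (8 * k)) * ‖p - g‖ ^ 2 + k * ((w - u) ^ 2 / edgeDistSq i j δ x) := by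
  have hQ := edgeDistSq_pos i j hδ x
  have hqQ : x i ^ 2 + x j ^ 2 ≤ edgeDistSq i j δ x := by
    unfold edgeDistSq
    linarith
  set Q := edgeDistSq i j δ x
  set e := p - g with he
  set t := x i * e i + x j * e j with ht
  have h1 : ‖g‖ ^ 2 ≤ 2 * ‖p‖ ^ 2 + 2 * ‖e‖ ^ 2 := by
    have : ‖g‖ ≤ ‖p‖ + ‖e‖ := by
      have : g = p - e := by simp [he]
      rw [this]
      exact norm_sub_le _ _
    nlinarith [norm_nonneg g, sq_nonneg (‖p‖ - ‖e‖)]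
  have h2 : inner ℝ e p ≤ 2 * k * ‖p‖ ^ 2 + ‖e‖ ^ 2 / (8 * k) := by
    refine (real_inner_le_norm e p).trans ?_
    rw [← sub_nonneg]
    have : 2 * k * ‖p‖ ^ 2 + ‖e‖ ^ 2 / (8 * k) - ‖e‖ * ‖p‖ =
        (4 * k * ‖p‖ - ‖e‖) ^ 2 / (8 * k) := by
      field_simp
      ring
    rw [this]
    positivity
  have h3 : t ^ 2 ≤ Q * ‖e‖ ^ 2 := by
    have h := sq_add_sq_le_norm_sq hij e
    have h' : t ^ 2 ≤ (x i ^ 2 + x j ^ 2) * (e i ^ 2 + e j ^ 2) := by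
      rw [ht]
      nlinarith [sq_nonneg (x i * e j - x j * e i)]
    exact h'.trans (mul_le_mul hqQ h (by positivity) hQ.le)
  have h4 : -(2 * s * w / Q * t) ≤ 16 * k * (w ^ 2 / Q) + 1 / (4 * k) * ‖e‖ ^ 2 := by
    have a1 : -(2 * s * w / Q * t) ≤ 16 * k * (w ^ 2 / Q) + s ^ 2 / (16 * k) * (t ^ 2 / Q) := by
      rw [← sub_nonneg]
      have : 16 * k * (w ^ 2 / Q) + s ^ 2 / (16 * k) * (t ^ 2 / Q) - -(2 * s * w / Q * t) =
          (16 * k * w + s * t) ^ 2 / (16 * k * Q) := by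
        field_simp
        ring
      rw [this]
      positivity
    have a2 : t ^ 2 / Q ≤ ‖e‖ ^ 2 := by rwa [div_le_iff₀' hQ]
    have a3 : s ^ 2 / (16 * k) ≤ 1 / (4 * k) := by
      rw [div_le_div_iff₀ (by positivity) (by positivity)]
      nlinarith
    linarith [mul_le_mul a3 a2 (by positivity) (by positivity)]
  have h5 : (1 + k) * w ≤ 16 * k * (w ^ 2 / Q) + (1 + k) ^ 2 / (64 * k) * Q := by
    rw [← sub_nonneg]
    have : 16 * k * (w ^ 2 / Q) + (1 + k) ^ 2 / (64 * k) * Q - (1 + k) * w =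
        (32 * k * w - (1 + k) * Q) ^ 2 / (64 * k * Q) := by
      field_simp
      ring
    rw [this]
    positivity
  -- Absorbing `u - w` in `Q` leaves an error quadratic in `w - u`, so `L²` convergence suffices.
  have h6 : u - w ≤ Q + (w - u) ^ 2 / Q := by
    rw [← sub_nonneg]
    have : Q + (w - u) ^ 2 / Q - (u - w) =
        ((Q + (w - u) / 2) ^ 2 + 3 / 4 * (w - u) ^ 2) / Q := by
      field_simp
      ring
    rw [this]
    positivity
  have h7 : 3 / (8 * k) * ‖e‖ ^ 2 = ‖e‖ ^ 2 / (8 * k) + 1 / (4 * k) * ‖e‖ ^ 2 := by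
    field_simp
    ring
  linear_combination k * h1 + h2 + h4 + h5 + k * h6 + h7

theorem edgeWeight_le (i j : Fin d) {s δ : ℝ} (hs : 0 ≤ s) (hδ : 0 < δ)
    (x : EuclideanSpace ℝ (Fin d)) : edgeWeight i j s δ x ≤ δ ^ (-s) :=
  Real.rpow_le_rpow_of_nonpos hδ (le_edgeDistSq i j δ x) (by linarith)

theorem integrable_edgeWeight_mul (i j : Fin d) {s δ : ℝ} (hs : 0 ≤ s) (hδ : 0 < δ)
    {μ : Measure (EuclideanSpace ℝ (Fin d))} {f : EuclideanSpace ℝ (Fin d) → ℝ}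
    (hf : Integrable f μ) : Integrable (fun x ↦ edgeWeight i j s δ x * f x) μ := by
  refine hf.bdd_mul (c := δ ^ (-s))
    (contDiff_edgeWeight i j s hδ (n := 0)).continuous.aestronglyMeasurable
    (Eventually.of_forall fun x ↦ ?_)
  rw [Real.norm_of_nonneg (edgeWeight_pos i j s hδ x).le]
  exact edgeWeight_le i j hs hδ x

theorem edgeWeight_mul_edgeDistSq (i j : Fin d) (s : ℝ) {δ : ℝ} (hδ : 0 < δ)
    (x : EuclideanSpace ℝ (Fin d)) :
    edgeWeight i j s δ x * edgeDistSq i j δ x = edgeWeight i j (s - 1) δ x := by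
  rw [edgeWeight, edgeWeight, ← Real.rpow_add_one (edgeDistSq_pos i j hδ x).ne']
  congr 1
  ring

/-- The weighted energy of the weak solution of `-Δu = 1` is controlled by the integral of
`(xᵢ² + xⱼ² + δ)^(1 - s)`, uniformly in `δ`. -/
theorem exists_weighted_energy_bound {i j : Fin d} (hij : i ≠ j)
    (hD : ∀ x ∈ D, x i ≠ 0 ∧ x j ≠ 0) (hvol : volume (D : Set (EuclideanSpace ℝ (Fin d))) ≠ ∞)
    {s : ℝ} (hs1 : 1 ≤ s) (hs : s < 2) :
    ∃ K : ℝ, 0 ≤ K ∧ ∀ (u : EuclideanSpace ℝ (Fin d) → ℝ)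
      (g : EuclideanSpace ℝ (Fin d) → EuclideanSpace ℝ (Fin d)),
      IsWeakSolution D (fun _ ↦ 1) (fun _ ↦ 1) u g → ∀ δ : ℝ, 0 < δ →
      ∫ x in (D : Set (EuclideanSpace ℝ (Fin d))), edgeWeight i j s δ x * (‖g x‖ ^ 2 + u x) ≤
        K * ∫ x in (D : Set (EuclideanSpace ℝ (Fin d))), edgeWeight i j (s - 1) δ x := by
  set k := (4 - s ^ 2) / 128 with hk
  have hk0 : 0 < k := by
    have : s ^ 2 < 4 := by nlinarith
    rw [hk]
    linarith
  set c := (1 + k) ^ 2 / (64 * k) + k with hc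
  refine ⟨c / k, by positivity, fun u g hug δ hδ ↦ ?_⟩
  have : Fact (volume (D : Set (EuclideanSpace ℝ (Fin d))) < ∞) := ⟨hvol.lt_top⟩
  obtain ⟨φ, hφ1, hφ2⟩ := hug.memH10.exists_approx
  have hu := hug.memH10.memLp
  have hg := hug.memH10.memLp_grad
  have hs0 : 0 ≤ s := by linarith
  have hρ := contDiff_edgeWeight (d := d) i j s hδ (n := (⊤ : ℕ∞))
  have hz (n : ℕ) : MemLp (fun x ↦ φ n x - u x) 2 (volume.restrict D) := ((φ n).memLp D 2).sub hu
  have he (n : ℕ) : MemLp (fun x ↦ gradient (φ n) x - g x) 2 (volume.restrict D) :=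
    ((φ n).memLp_gradient D 2).sub hg
  have hz2 (n : ℕ) := (memLp_two_iff_integrable_sq_norm (hz n).1).1 (hz n)
  have he2 (n : ℕ) := (memLp_two_iff_integrable_sq_norm (he n).1).1 (he n)
  set R := ∫ x in (D : Set (EuclideanSpace ℝ (Fin d))), edgeWeight i j (s - 1) δ x with hR
  -- The error terms are multiplied by bounds for the weights that depend on `δ`; they disappear
  -- in the limit.
  set C1 := (2 * k + 3 / (8 * k)) * δ ^ (-s) with hC1
  set C2 := k * (δ ^ (-s) / δ) with hC2
  have hmain (n : ℕ) : k * ∫ x in (D : Set (EuclideanSpace ℝ (Fin d))),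
        edgeWeight i j s δ x * (‖g x‖ ^ 2 + u x) ≤
      c * R + (C1 * (∫ x in (D : Set (EuclideanSpace ℝ (Fin d))), ‖gradient (φ n) x - g x‖ ^ 2)
        + C2 * ∫ x in (D : Set (EuclideanSpace ℝ (Fin d))), ‖φ n x - u x‖ ^ 2) := by
    -- Test the equation with `ρ φₙ` and replace `∇u` by `∇φₙ`, up to an error.
    set η : 𝓓(D, ℝ) := TestFunction.smoothMul (edgeWeight i j s δ) hρ (φ n) with hη
    have hcoer := weighted_coercivity hij hD hs0 hs hδ (φ n)
    have hweak := hug.integral_eq η (gradient η) η.memH10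
    simp only [one_mul] at hweak
    have i1 : IntegrableOn (fun x ↦ edgeWeight i j s δ x * ((4 - s ^ 2) / 32 *
        ‖gradient (φ n) x‖ ^ 2 + (4 - s ^ 2) / 4 * (φ n x ^ 2 / edgeDistSq i j δ x))) D := by
      refine integrable_edgeWeight_mul i j hs0 hδ (((memLp_two_iff_integrable_sq_norm
        ((φ n).memLp_gradient D 2).1).1 ((φ n).memLp_gradient D 2)).const_mul _ |>.add ?_)
      refine (Integrable.mul_bdd (c := δ⁻¹) ((φ n).memLp D 2).integrable_sq
        ((contDiff_edgeDistSq i j δ (n := 0)).continuous.inv₀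
          fun x ↦ (edgeDistSq_pos i j hδ x).ne').aestronglyMeasurable
          (Eventually.of_forall fun x ↦ ?_)).const_mul _
      rw [Pi.inv_apply, norm_inv, Real.norm_of_nonneg (edgeDistSq_pos i j hδ x).le]
      exact inv_anti₀ hδ (le_edgeDistSq i j δ x)
    have i2 : IntegrableOn (fun x ↦ inner ℝ (gradient (φ n) x) (gradient η x)) D :=
      integrable_inner_of_memLp_two ((φ n).memLp_gradient D 2) (η.memLp_gradient D 2)
    have i3 : IntegrableOn (fun x ↦ inner ℝ (g x) (gradient η x)) D :=
      integrable_inner_of_memLp_two hg (η.memLp_gradient D 2)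
    have i4 : IntegrableOn η D := (η.memLp D 2).integrable one_le_two
    have i5 : IntegrableOn (fun x ↦ edgeWeight i j (s - 1) δ x) D := by
      have h := integrable_edgeWeight_mul i j (sub_nonneg.2 hs1) hδ
        (integrable_const (μ := volume.restrict (D : Set (EuclideanSpace ℝ (Fin d)))) (1 : ℝ))
      simp only [mul_one] at h
      exact h
    have i6 := (he2 n).const_mul C1
    have i7 := (hz2 n).const_mul C2
    have i0 : IntegrableOn (fun x ↦ edgeWeight i j s δ x * (‖g x‖ ^ 2 + u x)) D :=
      integrable_edgeWeight_mul i j hs0 hδ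
        (((memLp_two_iff_integrable_sq_norm hg.1).1 hg).add (hu.integrable one_le_two))
    have hle : ∫ x in (D : Set (EuclideanSpace ℝ (Fin d))),
          k * (edgeWeight i j s δ x * (‖g x‖ ^ 2 + u x)) ≤
        ∫ x in (D : Set (EuclideanSpace ℝ (Fin d))), ((((edgeWeight i j s δ x *
            ((4 - s ^ 2) / 32 * ‖gradient (φ n) x‖ ^ 2
              + (4 - s ^ 2) / 4 * (φ n x ^ 2 / edgeDistSq i j δ x))
          - inner ℝ (gradient (φ n) x) (gradient η x)) + (inner ℝ (g x) (gradient η x) - η x))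
          + c * edgeWeight i j (s - 1) δ x)
          + (C1 * ‖gradient (φ n) x - g x‖ ^ 2 + C2 * ‖φ n x - u x‖ ^ 2)) := by
      refine integral_mono (i0.const_mul k)
        ((((i1.sub i2).add (i3.sub i4)).add (i5.const_mul c)).add (i6.add i7)) fun x ↦ ?_
      have hρ0 := edgeWeight_pos i j s hδ x
      have hQ := edgeDistSq_pos i j hδ x
      have hpt := mul_le_mul_of_nonneg_left (energy_pointwise hij (x := x) (g x)
        (gradient (φ n) x) (u x) (φ n x) (show s ^ 2 ≤ 4 by nlinarith) hk0 hδ) hρ0.le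
      have hin := inner_gradient_weight_mul i j s hδ (φ n) x (gradient (φ n) x - g x)
      have hin' : inner ℝ (gradient (φ n) x - g x)
          (gradient (fun y ↦ edgeWeight i j s δ y * φ n y) x) =
          inner ℝ (gradient (φ n) x) (gradient η x) - inner ℝ (g x) (gradient η x) :=
        inner_sub_left _ _ _
      have hηx : η x = edgeWeight i j s δ x * φ n x := rfl
      have hρQ := edgeWeight_mul_edgeDistSq i j s hδ x
      have b1 : edgeWeight i j s δ x * ((2 * k + 3 / (8 * k)) * ‖gradient (φ n) x - g x‖ ^ 2) ≤
          C1 * ‖gradient (φ n) x - g x‖ ^ 2 := by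
        rw [hC1, ← mul_assoc, mul_comm (edgeWeight i j s δ x)]
        gcongr
        exact edgeWeight_le i j hs0 hδ x
      have b2 : edgeWeight i j s δ x * (k * ((φ n x - u x) ^ 2 / edgeDistSq i j δ x)) ≤
          C2 * ‖φ n x - u x‖ ^ 2 := by
        have : edgeWeight i j s δ x * (k * ((φ n x - u x) ^ 2 / edgeDistSq i j δ x)) =
            k * (edgeWeight i j s δ x / edgeDistSq i j δ x) * (φ n x - u x) ^ 2 := by ring
        rw [this, hC2, Real.norm_eq_abs, sq_abs]
        gcongr
        · exact edgeWeight_le i j hs0 hδ x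
        · exact le_edgeDistSq i j δ x
      have hk4 : (4 - s ^ 2) / 32 = 4 * k := by rw [hk]; ring
      have hk32 : (4 - s ^ 2) / 4 = 32 * k := by rw [hk]; ring
      simp only [hk4, hk32]
      rw [hin'] at hin
      linear_combination hpt + b1 + b2 + hηx + hin + c * hρQ
    have hsplit := integral_add' (((i1.sub i2).add (i3.sub i4)).add (i5.const_mul c)) (i6.add i7)
    rw [integral_add' ((i1.sub i2).add (i3.sub i4)) (i5.const_mul c),
      integral_add' (i1.sub i2) (i3.sub i4), integral_sub' i1 i2, integral_sub' i3 i4,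
      integral_const_mul, integral_add' i6 i7, integral_const_mul, integral_const_mul, hweak,
      sub_self, add_zero] at hsplit
    rw [integral_const_mul] at hle
    replace hle := hle.trans_eq hsplit
    have hcoer' : ∫ x in (D : Set (EuclideanSpace ℝ (Fin d))), edgeWeight i j s δ x *
        ((4 - s ^ 2) / 32 * ‖gradient (φ n) x‖ ^ 2
          + (4 - s ^ 2) / 4 * (φ n x ^ 2 / edgeDistSq i j δ x)) ≤
      ∫ x in (D : Set (EuclideanSpace ℝ (Fin d))), inner ℝ (gradient (φ n) x) (gradient η x) :=
      hcoer
    linarith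
  have hlim : Tendsto (fun n ↦ c * R +
      (C1 * (∫ x in (D : Set (EuclideanSpace ℝ (Fin d))), ‖gradient (φ n) x - g x‖ ^ 2)
        + C2 * ∫ x in (D : Set (EuclideanSpace ℝ (Fin d))), ‖φ n x - u x‖ ^ 2)) atTop
      (𝓝 (c * R)) := by
    have h := (((tendsto_integral_norm_sq_of_eLpNorm he hφ2).const_mul C1).add
      ((tendsto_integral_norm_sq_of_eLpNorm hz hφ1).const_mul C2)).const_add (c * R)
    simpa using h
  have h := ge_of_tendsto' hlim hmain
  rw [div_mul_eq_mul_div, le_div_iff₀ hk0, mul_comm]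
  exact h

end EnergyBound

/-! ### The unit cube -/

section UnitCube

variable {d : ℕ}

theorem mem_unitCube {x : EuclideanSpace ℝ (Fin d)} :
    x ∈ unitCube d ↔ ∀ k, 0 < x k ∧ x k < 1 := Iff.rfl

/-- The open box with side intervals `(aₖ, bₖ)`. -/
def openBox (a b : Fin d → ℝ) : Set (EuclideanSpace ℝ (Fin d)) :=
  WithLp.ofLp ⁻¹' Set.univ.pi fun k ↦ Set.Ioo (a k) (b k)

theorem mem_openBox {a b : Fin d → ℝ} {x : EuclideanSpace ℝ (Fin d)} :
    x ∈ openBox a b ↔ ∀ k, a k < x k ∧ x k < b k := by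
  simp [openBox]

theorem measurableSet_openBox (a b : Fin d → ℝ) : MeasurableSet (openBox a b) :=
  (PiLp.volume_preserving_ofLp (Fin d)).measurable
    (MeasurableSet.univ_pi fun _ ↦ measurableSet_Ioo)

theorem volume_openBox (a b : Fin d → ℝ) :
    volume (openBox a b) = ∏ k, ENNReal.ofReal (b k - a k) := by
  rw [openBox, (PiLp.volume_preserving_ofLp (Fin d)).measure_preimage
    (MeasurableSet.univ_pi fun _ ↦ measurableSet_Ioo).nullMeasurableSet, Real.volume_pi_Ioo]

theorem coe_unitCube : (unitCube d : Set (EuclideanSpace ℝ (Fin d))) = openBox 0 1 := by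
  ext x
  simp [mem_openBox, mem_unitCube]

theorem volume_unitCube : volume (unitCube d : Set (EuclideanSpace ℝ (Fin d))) = 1 := by
  simp [coe_unitCube, volume_openBox]

/-- Poincaré inequality on the cube, as the unweighted case `s = 0` of the weighted coercivity. -/
theorem poincare_unitCube {i j : Fin d} (hij : i ≠ j) (φ : 𝓓(unitCube d, ℝ)) :
    ∫ x in (unitCube d : Set (EuclideanSpace ℝ (Fin d))), φ x ^ 2 ≤
      3 * ∫ x in (unitCube d : Set (EuclideanSpace ℝ (Fin d))), ‖gradient φ x‖ ^ 2 := by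
  have h := weighted_coercivity hij (D := unitCube d) (s := 0) (δ := 1)
    (fun x hx ↦ ⟨(hx i).1.ne', (hx j).1.ne'⟩) le_rfl two_pos one_pos φ
  have hw : ∀ x : EuclideanSpace ℝ (Fin d), edgeWeight i j 0 1 x = 1 := fun x ↦ by
    simp [edgeWeight]
  simp only [hw, one_mul, real_inner_self_eq_norm_sq] at h
  have hg := (memLp_two_iff_integrable_sq_norm (φ.memLp_gradient (unitCube d) 2).1).1
    (φ.memLp_gradient (unitCube d) 2)
  have hφ := (φ.memLp (unitCube d) 2).integrable_sq
  have hφ' : IntegrableOn (fun x ↦ φ x ^ 2 / edgeDistSq i j 1 x) (unitCube d) := by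
    refine Integrable.mul_bdd (c := 1) hφ ((contDiff_edgeDistSq i j 1 (n := 0)).continuous.inv₀
      fun x ↦ (edgeDistSq_pos i j one_pos x).ne').aestronglyMeasurable
      (Eventually.of_forall fun x ↦ ?_)
    rw [norm_inv, Real.norm_of_nonneg (edgeDistSq_pos i j one_pos x).le]
    exact inv_le_one_of_one_le₀ (le_edgeDistSq i j 1 x)
  have hmono : ∫ x in (unitCube d : Set (EuclideanSpace ℝ (Fin d))), 1 / 3 * φ x ^ 2 ≤
      ∫ x in (unitCube d : Set (EuclideanSpace ℝ (Fin d))),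
        ((4 - 0 ^ 2) / 32 * ‖gradient φ x‖ ^ 2
          + (4 - 0 ^ 2) / 4 * (φ x ^ 2 / edgeDistSq i j 1 x)) := by
    refine setIntegral_mono_on (hφ.const_mul _) ((hg.const_mul _).add (hφ'.const_mul _))
      (unitCube d).isOpen.measurableSet fun x hx ↦ ?_
    have hQ : edgeDistSq i j 1 x ≤ 3 := by
      have h1 := hx i
      have h2 := hx j
      unfold edgeDistSq
      nlinarith
    have h3 : φ x ^ 2 / 3 ≤ φ x ^ 2 / edgeDistSq i j 1 x :=
      div_le_div_of_nonneg_left (sq_nonneg _) (edgeDistSq_pos i j one_pos x) hQ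
    linarith [sq_nonneg ‖gradient φ x‖]
  rw [integral_const_mul] at hmono
  linarith

/-- Uniform bound for the integral of the regularised weight with exponent below one: the weight is
dominated by the integrable function `(xᵢ xⱼ)^(-t)`. -/
theorem exists_integral_edgeWeight_le {i j : Fin d} (hij : i ≠ j) {t : ℝ} (ht0 : 0 ≤ t)
    (ht : t < 1) :
    ∃ C : ℝ, ∀ δ : ℝ, 0 < δ →
      ∫ x in (unitCube d : Set (EuclideanSpace ℝ (Fin d))), edgeWeight i j t δ x ≤ C := by
  set e : Fin d → ℝ := fun k ↦ if k = i ∨ k = j then -t else 0 with he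
  set f : Fin d → ℝ → ℝ := fun k ↦ (Set.Ioo 0 1).indicator fun y ↦ y ^ e k with hf
  have hfi : ∀ k, Integrable (f k) := fun k ↦ by
    have hek : -1 < e k := by
      simp only [he]
      split_ifs <;> linarith
    rw [hf, integrable_indicator_iff measurableSet_Ioo, ← integrableOn_Ioc_iff_integrableOn_Ioo,
      ← intervalIntegrable_iff_integrableOn_Ioc_of_le zero_le_one]
    exact intervalIntegral.intervalIntegrable_rpow' hek
  have hint : Integrable fun x : EuclideanSpace ℝ (Fin d) ↦ ∏ k, f k (x k) :=
    (PiLp.volume_preserving_ofLp (Fin d)).integrable_comp_of_integrable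
      (Integrable.fintype_prod hfi)
  refine ⟨∫ x in (unitCube d : Set (EuclideanSpace ℝ (Fin d))), ∏ k, f k (x k),
    fun δ hδ ↦ ?_⟩
  refine integral_mono_of_nonneg (Eventually.of_forall fun x ↦ (edgeWeight_pos i j t hδ x).le)
    hint.integrableOn ?_
  refine (ae_restrict_iff' (unitCube d).isOpen.measurableSet).2 (Eventually.of_forall
    fun x hx ↦ ?_)
  have hxi := hx i
  have hxj := hx j
  have hprod : ∏ k, f k (x k) = x i ^ (-t) * x j ^ (-t) := by
    have h1 : ∀ k, f k (x k) = x k ^ e k := fun k ↦ Set.indicator_of_mem (Set.mem_Ioo.2 (hx k)) _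
    simp only [h1]
    rw [Finset.prod_eq_mul i j hij (fun k _ hk ↦ by simp [he, hk.1, hk.2]) (by simp) (by simp)]
    simp [he]
  simp only [hprod]
  rw [← Real.mul_rpow hxi.1.le hxj.1.le]
  refine Real.rpow_le_rpow_of_nonpos (mul_pos hxi.1 hxj.1) ?_ (by linarith)
  unfold edgeDistSq
  nlinarith [sq_nonneg (x i - x j), mul_pos hxi.1 hxj.1]

theorem exists_mem_frontier_unitCube_dist_le {x : EuclideanSpace ℝ (Fin d)}
    (hx : x ∈ unitCube d) (i : Fin d) :
    ∃ y ∈ frontier (unitCube d : Set (EuclideanSpace ℝ (Fin d))), dist x y ≤ 1 := by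
  refine ⟨x + (-x i) • EuclideanSpace.single i (1 : ℝ), ⟨?_, ?_⟩, ?_⟩
  · have hc : Tendsto (fun t : ℝ ↦ x + t • EuclideanSpace.single i (1 : ℝ)) (𝓝[>] (-x i))
        (𝓝 (x + (-x i) • EuclideanSpace.single i (1 : ℝ))) :=
      (Continuous.tendsto (by fun_prop) _).mono_left nhdsWithin_le_nhds
    refine mem_closure_of_tendsto hc ?_
    filter_upwards [Ioo_mem_nhdsGT (neg_lt_zero.2 (hx i).1)] with t ht k
    have hxk := hx k
    by_cases hk : k = i
    · subst hk
      simp only [PiLp.add_apply, PiLp.smul_apply, PiLp.single_apply, if_true, smul_eq_mul, mul_one]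
      exact ⟨by linarith [ht.1], by linarith [ht.2]⟩
    · simpa [PiLp.single_apply, hk] using hxk
  · rw [(unitCube d).isOpen.interior_eq]
    intro h
    simpa using (h i).1
  · have hxi := hx i
    simp only [dist_self_add_right, norm_smul, PiLp.norm_single, norm_neg,
      Real.norm_eq_abs, abs_one, mul_one]
    rw [abs_of_pos hxi.1]
    exact hxi.2.le

theorem infDist_frontier_unitCube_le_one (i : Fin d) {x : EuclideanSpace ℝ (Fin d)}
    (hx : x ∈ unitCube d) :
    Metric.infDist x (frontier (unitCube d : Set (EuclideanSpace ℝ (Fin d)))) ≤ 1 := by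
  obtain ⟨y, hy, hxy⟩ := exists_mem_frontier_unitCube_dist_le hx i
  exact (Metric.infDist_le_dist_of_mem hy).trans hxy

theorem le_infDist_frontier_unitCube (i : Fin d) {x : EuclideanSpace ℝ (Fin d)} {r : ℝ}
    (hr : 0 < r) (hx : ∀ k, r ≤ x k ∧ x k ≤ 1 - r) :
    r ≤ Metric.infDist x (frontier (unitCube d : Set (EuclideanSpace ℝ (Fin d)))) := by
  have hxD : x ∈ unitCube d := fun k ↦ ⟨by linarith [hx k], by linarith [hx k]⟩
  obtain ⟨z, hz, -⟩ := exists_mem_frontier_unitCube_dist_le hxD i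
  refine (Metric.le_infDist ⟨z, hz⟩).2 fun y hy ↦ ?_
  have hy' : y ∉ unitCube d := by
    have h := hy.2
    rwa [(unitCube d).isOpen.interior_eq] at h
  rw [mem_unitCube] at hy'
  push Not at hy'
  obtain ⟨k, hk⟩ := hy'
  have h1 : |x k - y k| ≤ dist x y := by
    rw [dist_eq_norm]
    exact PiLp.norm_apply_le (x - y) k
  refine le_trans ?_ h1
  have hxk := hx k
  by_cases h0 : 0 < y k
  · have := hk h0
    rw [le_abs]
    right
    linarith
  · rw [le_abs]
    left
    linarith

end UnitCube

/-! ### Failure of the lower bound near an edge -/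

section Failure

variable {d : ℕ}

/-- A weighted integral bound near the edge `{xᵢ = xⱼ = 0}` is incompatible with the lower bound
`c dist(x, ∂D)^γ` on the cube: test on boxes of side length `r → 0` near the edge. -/
theorem not_lower_bound_of_weighted_integral_le {i j : Fin d} (hij : i ≠ j)
    {w : EuclideanSpace ℝ (Fin d) → ℝ} (hw : IntegrableOn w (unitCube d))
    {s M c β γ : ℝ} (hs : 0 ≤ s) (hc : 0 < c) (hγ0 : 0 ≤ γ) (hβγ : β ≤ γ)
    (hγs : 2 + γ < 2 * s)
    (hM : ∀ δ : ℝ, 0 < δ →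
      ∫ x in (unitCube d : Set (EuclideanSpace ℝ (Fin d))), edgeWeight i j s δ x * w x ≤ M) :
    ¬ ∀ᵐ x ∂(volume.restrict (unitCube d : Set (EuclideanSpace ℝ (Fin d)))),
      c * Metric.infDist x (frontier (unitCube d : Set (EuclideanSpace ℝ (Fin d)))) ^ β ≤ w x := by
  intro hlow
  -- The volume factor contributed by the directions along the edge.
  set V : ℝ := ∏ k : Fin d, if k = i ∨ k = j then (1 : ℝ) else 1 / 2 with hV
  have hV0 : 0 < V := Finset.prod_pos fun k _ ↦ by split_ifs <;> norm_num
  have key : ∀ r : ℝ, 0 < r → r ≤ 1 / 4 →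
      c * V * 9 ^ (-s) ≤ M * r ^ (2 * s - 2 - γ) := by
    intro r hr hr4
    -- A box at distance `r` from the edge, kept away from all other faces.
    set a : Fin d → ℝ := fun k ↦ if k = i ∨ k = j then r else 1 / 4 with ha
    set b : Fin d → ℝ := fun k ↦ if k = i ∨ k = j then 2 * r else 3 / 4 with hb
    have hS : ∀ x ∈ openBox a b, ∀ k, r ≤ x k ∧ x k ≤ 1 - r := by
      intro x hx k
      have h := mem_openBox.1 hx k
      simp only [ha, hb] at h
      split_ifs at h <;> constructor <;> linarith
    have hsub : openBox a b ⊆ (unitCube d : Set (EuclideanSpace ℝ (Fin d))) := fun x hx k ↦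
      ⟨by linarith [hS x hx k], by linarith [hS x hx k]⟩
    have hvol : volume.real (openBox a b) = r ^ 2 * V := by
      have h1 : ∀ k, b k - a k =
          (if k = i ∨ k = j then r else 1) * (if k = i ∨ k = j then (1 : ℝ) else 1 / 2) :=
        fun k ↦ by
          simp only [ha, hb]
          split_ifs <;> ring
      have h0 : ∀ k, 0 ≤ b k - a k := fun k ↦ by
        rw [h1]
        split_ifs <;> positivity
      rw [measureReal_def, volume_openBox, ← ENNReal.ofReal_prod_of_nonneg fun k _ ↦ h0 k,
        ENNReal.toReal_ofReal (Finset.prod_nonneg fun k _ ↦ h0 k)]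
      simp only [h1]
      rw [Finset.prod_mul_distrib, ← hV, Finset.prod_eq_mul i j hij
        (fun k _ hk ↦ by simp [hk.1, hk.2]) (by simp) (by simp)]
      simp [sq]
    -- The regularisation `δ = r²` keeps the weight comparable to `r ^ (-2s)` on the box.
    have hδ : 0 < r ^ 2 := by positivity
    have hint := integrable_edgeWeight_mul i j hs hδ hw
    have hnonneg : 0 ≤ᵐ[volume.restrict (unitCube d : Set (EuclideanSpace ℝ (Fin d)))]
        fun x ↦ edgeWeight i j s (r ^ 2) x * w x := by
      filter_upwards [hlow] with x hx
      exact mul_nonneg (edgeWeight_pos i j s hδ x).le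
        (le_trans (mul_nonneg hc.le (Real.rpow_nonneg Metric.infDist_nonneg _)) hx)
    have hbox : ∫ x in openBox a b, (9 * r ^ 2) ^ (-s) * (c * r ^ γ) ≤
        ∫ x in openBox a b, edgeWeight i j s (r ^ 2) x * w x := by
      have hfin : volume (openBox a b) ≠ ∞ :=
        ne_top_of_le_ne_top (by simp [volume_unitCube]) (measure_mono hsub)
      refine integral_mono_ae (integrableOn_const hfin) (hint.mono_measure
        (Measure.restrict_mono hsub le_rfl)) ?_
      filter_upwards [ae_restrict_of_ae_restrict_of_subset hsub hlow,
        ae_restrict_mem (measurableSet_openBox a b)] with x hx hxS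
      have hd1 := infDist_frontier_unitCube_le_one i (hsub hxS)
      have hd2 := le_infDist_frontier_unitCube i hr (hS x hxS)
      refine mul_le_mul ?_ ((mul_le_mul_of_nonneg_left ?_ hc.le).trans hx) (by positivity)
        (edgeWeight_pos i j s hδ x).le
      · refine Real.rpow_le_rpow_of_nonpos (edgeDistSq_pos i j hδ x) ?_ (by linarith)
        have hi := mem_openBox.1 hxS i
        have hj := mem_openBox.1 hxS j
        simp only [ha, hb, true_or, or_true, if_true] at hi hj
        unfold edgeDistSq
        nlinarith
      · exact (Real.rpow_le_rpow hr.le hd2 hγ0).trans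
          (Real.rpow_le_rpow_of_exponent_ge (hr.trans_le hd2) hd1 hβγ)
    rw [setIntegral_const, hvol, smul_eq_mul] at hbox
    have htotal := (hbox.trans (setIntegral_mono_set hint hnonneg
      hsub.eventuallyLE)).trans (hM _ hδ)
    have hpow : r ^ 2 * V * ((9 * r ^ 2) ^ (-s) * (c * r ^ γ)) * r ^ (2 * s - 2 - γ) =
        c * V * 9 ^ (-s) := by
      have e1 : (9 * r ^ 2) ^ (-s) = 9 ^ (-s) * r ^ (-(2 * s)) := by
        rw [Real.mul_rpow (by norm_num) hδ.le, ← Real.rpow_natCast r 2, ← Real.rpow_mul hr.le]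
        congr 2
        push_cast
        ring
      have e2 : r ^ (2 : ℕ) * r ^ (-(2 * s)) * r ^ γ * r ^ (2 * s - 2 - γ) = 1 := by
        rw [← Real.rpow_natCast r 2, ← Real.rpow_add hr, ← Real.rpow_add hr, ← Real.rpow_add hr,
          ← Real.rpow_zero r]
        congr 1
        push_cast
        ring
      rw [e1]
      linear_combination c * V * 9 ^ (-s) * e2
    rw [← hpow]
    exact mul_le_mul_of_nonneg_right htotal (by positivity)
  have hlim : Tendsto (fun r : ℝ ↦ M * r ^ (2 * s - 2 - γ)) (𝓝[>] 0) (𝓝 0) := by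
    have hexp : 0 < 2 * s - 2 - γ := by linarith
    have h := ((Real.continuousAt_rpow_const 0 _ (Or.inr hexp.le)).tendsto.const_mul M).mono_left
      (nhdsWithin_le_nhds (s := Set.Ioi (0 : ℝ)))
    rwa [Real.zero_rpow hexp.ne', mul_zero] at h
  have hpos : 0 < c * V * 9 ^ (-s) := by positivity
  refine absurd (ge_of_tendsto hlim ?_) (not_le.2 hpos)
  filter_upwards [Ioc_mem_nhdsGT (show (0 : ℝ) < 1 / 4 by norm_num)] with r hr
  exact key r hr.1 hr.2

end Failure

theorem proposition3p6 (d : ℕ) (hd : 2 ≤ d) (β : ℝ) (hβ : β < 2) :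
    ¬ PositivityCondition (unitCube d) (fun _ ↦ 1) (fun _ ↦ 1) β := by
  rintro ⟨c, hc, h⟩
  let i : Fin d := ⟨0, by omega⟩
  let j : Fin d := ⟨1, by omega⟩
  have hij : i ≠ j := by simp [i, j]
  have hvol : volume (unitCube d : Set (EuclideanSpace ℝ (Fin d))) ≠ ∞ := by
    simp [volume_unitCube]
  have : Fact (volume (unitCube d : Set (EuclideanSpace ℝ (Fin d))) < ∞) := ⟨hvol.lt_top⟩
  obtain ⟨u, g, hug⟩ := exists_isWeakSolution (poincare_unitCube hij) (memLp_const (1 : ℝ))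
  -- Distances to the boundary are at most one, so `β` may be increased to a nonnegative exponent;
  -- the weight exponent `s` is the midpoint of the admissible range `(1 + γ / 2, 2)`.
  set γ := max β 0 with hγ
  have hγ2 : γ < 2 := max_lt hβ two_pos
  have hγ0 : 0 ≤ γ := le_max_right _ _
  set s := (6 + γ) / 4 with hs
  obtain ⟨K, hK, hE⟩ := exists_weighted_energy_bound hij (D := unitCube d)
    (fun x hx ↦ ⟨(hx i).1.ne', (hx j).1.ne'⟩) hvol (s := s) (by linarith) (by linarith)
  obtain ⟨C, hC⟩ := exists_integral_edgeWeight_le hij (t := s - 1) (by linarith) (by linarith)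
  have hw : IntegrableOn (fun x ↦ ‖g x‖ ^ 2 + u x) (unitCube d) :=
    ((memLp_two_iff_integrable_sq_norm hug.memH10.memLp_grad.1).1 hug.memH10.memLp_grad).add
      (hug.memH10.memLp.integrable one_le_two)
  refine not_lower_bound_of_weighted_integral_le hij hw (s := s) (M := K * C) (by linarith) hc hγ0
    (le_max_left β 0) (by linarith) (fun δ hδ ↦ ?_) ?_
  · exact (hE u g hug δ hδ).trans (mul_le_mul_of_nonneg_left (hC δ hδ) hK)
  · simpa only [one_mul] using h u g hug
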